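/- Let $\mathbb{Z}^+=\{0,1,2,\dots\}$ and let $\mathbb{P}(\mathbb{Z}^+)$ be the set of probabilities on $\mathbb{Z}^+$, that is, of functions $F:\mathbb{Z}^+\to[0,1]$ with $\sum_{k\ge 0}F(k)=1$. Write $(F*G)(m)=\sum_{k=0}^{m}F(k)\,G(m-k)$ for convolution, let $F^{(n)}$ be the $n$-th convolution power of $F$ (with $F^{(0)}=\delta_0$, the unit mass at $0$), and let $\|F\|_1=\sum_{k\ge 0}|F(k)|$. Define $$\mathcal{A}=\Bigl\{F\in\mathbb{P}(\mathbb{Z}^+) : \sup_{n\ge 1}\, n\,\bigl\|F^{(n)}-F^{(n+1)}\bigr\|_1<\infty\Bigr\}.$$ Then $\mathcal{A}$ is a convex subset of $\mathbb{P}(\mathbb{Z}^+)$. Moreover, for all $F_1,F_2\in\mathcal{A}$ and every $G\in\mathbb{P}(\mathbb{Z}^+)$ one has $F_1*F_2\in\mathcal{A}$ and $$\sum_{k\ge 0}F_1(k)\,G^{(k)}\in\mathcal{A},$$ where the series converges in the norm $\|\cdot\|_1$. -/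

import Mathlib

open scoped ENNReal

namespace RittProb

/-- The set `ℙ(ℤ⁺)` of probabilities on `ℤ⁺ = {0, 1, 2, …}`: nonnegative functions of total mass
`1`. A function on `ℤ⁺` is identified with its extension by zero to `ℤ`. -/
def Prob : Set (ℕ → ℝ) :=
  {F | (∀ k, 0 ≤ F k) ∧ HasSum F 1}

/-- The unit mass at `m`. -/
def dirac (m : ℕ) : ℕ → ℝ := fun k => if k = m then 1 else 0

/-- Convolution, `(F * G)(m) = ∑_k F(k) G(m - k)`. Since both functions vanish at negative
integers, only the finitely many indices `0 ≤ k ≤ m` contribute. -/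
def conv (F G : ℕ → ℝ) : ℕ → ℝ :=
  fun m => ∑ p ∈ Finset.HasAntidiagonal.antidiagonal m, F p.1 * G p.2

/-- The convolution powers `F^{(n)}`, with `F^{(0)} = δ₀`. -/
def convPow (F : ℕ → ℝ) : ℕ → ℕ → ℝ
  | 0 => dirac 0
  | n + 1 => conv F (convPow F n)

/-- The `L¹` norm `∑_k |F(k)|`, with values in `[0, ∞]`. -/
noncomputable def l1Norm (F : ℕ → ℝ) : ℝ≥0∞ := ∑' k, ‖F k‖ₑ

/-- The class `𝒜` of Ritt probabilities:
those `F ∈ ℙ(ℤ⁺)` with `sup_{n ≥ 1} n ‖F^{(n)} - F^{(n+1)}‖ < ∞`. -/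
def classA : Set (ℕ → ℝ) :=
  {F | F ∈ Prob ∧
    ⨆ n : ℕ, ⨆ _ : 1 ≤ n, (n : ℝ≥0∞) * l1Norm (convPow F n - convPow F (n + 1)) < ∞}

/-- The subordinated function `∑_{k ≥ 0} F(k) G^{(k)}`, with the sum taken pointwise. -/
noncomputable def subord (F G : ℕ → ℝ) : ℕ → ℝ :=
  fun m => ∑' k, F k * convPow G k m

end RittProb

namespace RittProb

/-! Generating functions turn convolution into multiplication in `ℝ⟦X⟧`, where the `L¹` norm is
submultiplicative and probabilities have norm `1`. Membership in `classA` becomes a bound on `(n +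
1) ‖f ^ n (1 - f)‖`. Products telescope: `1 - f g = (1 - f) + f (1 - g)`, so the constants add
(`RittBound.mul`). For convex combinations, `1 - (a f + b g) = a (1 - f) + b (1 - g)`, and each half
is handled by a binomial expansion (`RittBound.convex_aux`). For fixed `G`, `F ↦ subord F G` is an
`L¹`-contractive algebra homomorphism (`subord_conv`, `l1Norm_tsum_mul_le`), so it preserves the
Ritt bound. -/

open PowerSeries Finset

/-- The `L¹` norm of the coefficient sequence of a power series. -/
noncomputable def psNorm (f : ℝ⟦X⟧) : ℝ≥0∞ := l1Norm fun k => coeff k f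

lemma psNorm_mk (F : ℕ → ℝ) : psNorm (PowerSeries.mk F) = l1Norm F := by
  simp [psNorm]

lemma mk_conv (F G : ℕ → ℝ) :
    PowerSeries.mk (conv F G) = PowerSeries.mk F * PowerSeries.mk G := by
  ext m
  simp [conv, coeff_mul]

lemma mk_dirac_zero : PowerSeries.mk (dirac 0) = 1 := by
  ext m
  simp [dirac, coeff_one]

lemma mk_convPow (F : ℕ → ℝ) (n : ℕ) :
    PowerSeries.mk (convPow F n) = PowerSeries.mk F ^ n := by
  induction n with
  | zero => simp [convPow, mk_dirac_zero]
  | succ n ih => rw [convPow, mk_conv, ih, pow_succ']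

lemma mk_injective {F G : ℕ → ℝ} (h : PowerSeries.mk F = PowerSeries.mk G) : F = G := by
  funext k
  simpa using congrArg (coeff k) h

lemma conv_convPow (G : ℕ → ℝ) (k l : ℕ) :
    conv (convPow G k) (convPow G l) = convPow G (k + l) :=
  mk_injective <| by simp only [mk_conv, mk_convPow, pow_add]

/-! ### The `L¹` norm, convolution and probabilities -/

lemma l1Norm_add_le (F G : ℕ → ℝ) : l1Norm (F + G) ≤ l1Norm F + l1Norm G := by
  unfold l1Norm
  rw [← ENNReal.tsum_add]
  exact ENNReal.tsum_le_tsum fun k => enorm_add_le _ _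

lemma l1Norm_smul (a : ℝ) (F : ℕ → ℝ) : l1Norm (a • F) = ‖a‖ₑ * l1Norm F := by
  unfold l1Norm
  rw [← ENNReal.tsum_mul_left]
  simp [enorm_mul]

lemma tsum_sum_antidiagonal_mul (u v : ℕ → ℝ≥0∞) :
    ∑' m, ∑ p ∈ antidiagonal m, u p.1 * v p.2 = (∑' k, u k) * ∑' k, v k := by
  have h : ∀ m, ∑ p ∈ antidiagonal m, u p.1 * v p.2
      = ∑' p : antidiagonal m, u p.1.1 * v p.1.2 := fun m => by
    rw [tsum_fintype, ← Finset.sum_coe_sort]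
  simp_rw [h]
  rw [← ENNReal.tsum_sigma' fun q : (Σ m : ℕ, antidiagonal m) => u q.2.1.1 * v q.2.1.2,
    ← ENNReal.tsum_mul_right]
  simp_rw [← ENNReal.tsum_mul_left]
  rw [← ENNReal.tsum_prod, ← HasAntidiagonal.sigmaAntidiagonalEquivProd.tsum_eq]
  rfl

lemma l1Norm_conv_le (F G : ℕ → ℝ) : l1Norm (conv F G) ≤ l1Norm F * l1Norm G := by
  unfold l1Norm conv
  rw [← tsum_sum_antidiagonal_mul]
  refine ENNReal.tsum_le_tsum fun m => (enorm_sum_le _ _).trans ?_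
  simp [enorm_mul]

lemma l1Norm_conv_of_nonneg {F G : ℕ → ℝ} (hF : ∀ k, 0 ≤ F k) (hG : ∀ k, 0 ≤ G k) :
    l1Norm (conv F G) = l1Norm F * l1Norm G := by
  unfold l1Norm conv
  rw [← tsum_sum_antidiagonal_mul]
  refine tsum_congr fun m => ?_
  rw [Real.enorm_of_nonneg (sum_nonneg fun p _ => mul_nonneg (hF _) (hG _)),
    ENNReal.ofReal_sum_of_nonneg fun p _ => mul_nonneg (hF _) (hG _)]
  refine sum_congr rfl fun p _ => ?_
  rw [ENNReal.ofReal_mul (hF _), Real.enorm_of_nonneg (hF _), Real.enorm_of_nonneg (hG _)]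

lemma summable_of_l1Norm_ne_top {F : ℕ → ℝ} (h : l1Norm F ≠ ∞) : Summable F := by
  refine Summable.of_norm (NNReal.summable_coe.2 ?_ : Summable fun k => ((‖F k‖₊ : NNReal) : ℝ))
  exact ENNReal.tsum_coe_ne_top_iff_summable.1 h

lemma mem_prob_iff {F : ℕ → ℝ} : F ∈ Prob ↔ (∀ k, 0 ≤ F k) ∧ l1Norm F = 1 := by
  have key (h : ∀ k, 0 ≤ F k) (hs : Summable F) : l1Norm F = ENNReal.ofReal (∑' k, F k) := by
    rw [ENNReal.ofReal_tsum_of_nonneg h hs]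
    exact tsum_congr fun k => Real.enorm_of_nonneg (h k)
  refine and_congr_right fun h => ⟨fun hs => ?_, fun hn => ?_⟩
  · simp [key h hs.summable, hs.tsum_eq]
  · have hs : Summable F := summable_of_l1Norm_ne_top (by simp [hn])
    rw [key h hs, ENNReal.ofReal_eq_one] at hn
    exact hn ▸ hs.hasSum

lemma dirac_zero_mem_prob : dirac 0 ∈ Prob :=
  ⟨fun k => by unfold dirac; split_ifs <;> simp, hasSum_ite_eq 0 1⟩

lemma conv_mem_prob {F G : ℕ → ℝ} (hF : F ∈ Prob) (hG : G ∈ Prob) : conv F G ∈ Prob := by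
  rw [mem_prob_iff] at *
  refine ⟨fun m => sum_nonneg fun p _ => mul_nonneg (hF.1 _) (hG.1 _), ?_⟩
  rw [l1Norm_conv_of_nonneg hF.1 hG.1, hF.2, hG.2, one_mul]

lemma convPow_mem_prob {F : ℕ → ℝ} (hF : F ∈ Prob) (n : ℕ) : convPow F n ∈ Prob := by
  induction n with
  | zero => exact dirac_zero_mem_prob
  | succ n ih => exact conv_mem_prob hF ih

lemma convex_prob : Convex ℝ Prob := by
  intro F hF G hG a b ha hb hab
  refine ⟨fun k => add_nonneg (mul_nonneg ha (hF.1 k)) (mul_nonneg hb (hG.1 k)), ?_⟩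
  have h := (hF.2.mul_left a).add (hG.2.mul_left b)
  rwa [mul_one, mul_one, hab] at h

lemma psNorm_add_le (f g : ℝ⟦X⟧) : psNorm (f + g) ≤ psNorm f + psNorm g :=
  (le_of_eq (congrArg l1Norm (by ext; simp))).trans (l1Norm_add_le _ _)

lemma psNorm_zero : psNorm 0 = 0 := by simp [psNorm, l1Norm]

lemma psNorm_one : psNorm 1 = 1 := by
  rw [← mk_dirac_zero, psNorm_mk]
  exact (mem_prob_iff.1 dirac_zero_mem_prob).2

lemma psNorm_smul (a : ℝ) (f : ℝ⟦X⟧) : psNorm (a • f) = ‖a‖ₑ * psNorm f :=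
  (congrArg l1Norm (by ext; simp)).trans (l1Norm_smul a _)

lemma psNorm_mul_le (f g : ℝ⟦X⟧) : psNorm (f * g) ≤ psNorm f * psNorm g :=
  (le_of_eq (congrArg l1Norm (by ext; simp [conv, coeff_mul]))).trans (l1Norm_conv_le _ _)

lemma psNorm_sum_le {ι : Type*} (s : Finset ι) (f : ι → ℝ⟦X⟧) :
    psNorm (∑ i ∈ s, f i) ≤ ∑ i ∈ s, psNorm (f i) :=
  le_sum_of_subadditive psNorm psNorm_zero.le psNorm_add_le s f

lemma psNorm_pow_le_one {f : ℝ⟦X⟧} (hf : psNorm f ≤ 1) (n : ℕ) : psNorm (f ^ n) ≤ 1 := by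
  induction n with
  | zero => simp [psNorm_one]
  | succ n ih =>
    rw [pow_succ]
    exact (psNorm_mul_le _ _).trans (mul_le_one' ih hf)

lemma psNorm_mul_le_of_le_one {f : ℝ⟦X⟧} (hf : psNorm f ≤ 1) (g : ℝ⟦X⟧) :
    psNorm (f * g) ≤ psNorm g :=
  (psNorm_mul_le _ _).trans (mul_le_of_le_one_left' hf)

/-! ### The Ritt condition under products and convex combinations -/

/-- The Ritt condition `(n + 1) ‖f ^ n (1 - f)‖ ≤ C` for all `n`, including `n = 0`. -/
def RittBound (f : ℝ⟦X⟧) (C : ℝ≥0∞) : Prop :=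
  ∀ n : ℕ, (n + 1 : ℝ≥0∞) * psNorm (f ^ n * (1 - f)) ≤ C

lemma l1Norm_convPow_sub (F : ℕ → ℝ) (n : ℕ) :
    l1Norm (convPow F n - convPow F (n + 1))
      = psNorm (PowerSeries.mk F ^ n * (1 - PowerSeries.mk F)) := by
  rw [mul_sub, mul_one, ← pow_succ, ← mk_convPow, ← mk_convPow, psNorm]
  congr 1
  ext k
  simp

lemma mem_classA_iff {F : ℕ → ℝ} :
    F ∈ classA ↔ F ∈ Prob ∧ ∃ C < ∞, RittBound (PowerSeries.mk F) C := by
  unfold classA RittBound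
  simp only [Set.mem_ofPred_eq, l1Norm_convPow_sub]
  refine and_congr_right fun hF => ⟨fun h => ?_, fun ⟨C, hC, h⟩ => ?_⟩
  · set S := ⨆ n : ℕ, ⨆ _ : 1 ≤ n,
      (n : ℝ≥0∞) * psNorm (PowerSeries.mk F ^ n * (1 - PowerSeries.mk F))
    have hF1 : psNorm (PowerSeries.mk F) ≤ 1 := by
      rw [psNorm_mk, (mem_prob_iff.1 hF).2]
    have h0 : psNorm (1 - PowerSeries.mk F) ≤ 2 := by
      have : 1 - PowerSeries.mk F = 1 + (-1 : ℝ) • PowerSeries.mk F := by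
        rw [neg_one_smul, sub_eq_add_neg]
      rw [this, ← one_add_one_eq_two]
      refine (psNorm_add_le _ _).trans (add_le_add psNorm_one.le ?_)
      rw [psNorm_smul, enorm_neg, enorm_one, one_mul]
      exact hF1
    -- Replacing the weight `n` by `n + 1` costs one more `‖f ^ n (1 - f)‖`, at most `2`.
    refine ⟨S + 2, by simp [h], fun n => ?_⟩
    rw [add_mul, one_mul]
    refine add_le_add ?_ ((psNorm_mul_le_of_le_one (psNorm_pow_le_one hF1 n) _).trans h0)
    rcases Nat.eq_zero_or_pos n with rfl | hn
    · simp
    · exact le_iSup₂ (f := fun (n : ℕ) (_ : 1 ≤ n) =>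
        (n : ℝ≥0∞) * psNorm (PowerSeries.mk F ^ n * (1 - PowerSeries.mk F))) n hn
  · refine lt_of_le_of_lt (iSup₂_le fun n _ => ?_) hC
    exact (mul_le_mul_left le_self_add _).trans (h n)

lemma RittBound.mul {f g : ℝ⟦X⟧} {C D : ℝ≥0∞} (hf : psNorm f ≤ 1) (hg : psNorm g ≤ 1)
    (hC : RittBound f C) (hD : RittBound g D) : RittBound (f * g) (C + D) := by
  intro n
  have h : (f * g) ^ n * (1 - f * g)
      = g ^ n * (f ^ n * (1 - f)) + f ^ (n + 1) * (g ^ n * (1 - g)) := by ring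
  rw [h]
  refine le_trans ?_ (add_le_add (hC n) (hD n))
  rw [← mul_add]
  refine mul_le_mul_right ((psNorm_add_le _ _).trans (add_le_add ?_ ?_)) _
  · exact psNorm_mul_le_of_le_one (psNorm_pow_le_one hg n) _
  · exact psNorm_mul_le_of_le_one (psNorm_pow_le_one hf _) _

/-- One half of the Ritt estimate for a convex combination: in the binomial expansion of
`(a f + b g) ^ n`, use `(n + 1) choose n k = (k + 1) choose (n + 1) (k + 1)`. -/
lemma RittBound.convex_aux {f g : ℝ⟦X⟧} {C : ℝ≥0∞} (hg : psNorm g ≤ 1)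
    (hC : RittBound f C) {a b : ℝ} (ha : 0 ≤ a) (hb : 0 ≤ b) (hab : a + b = 1) (n : ℕ) :
    (n + 1 : ℝ≥0∞) * psNorm ((a • f + b • g) ^ n * (a • (1 - f))) ≤ C := by
  have hexp : (a • f + b • g) ^ n * (a • (1 - f)) = ∑ k ∈ range (n + 1),
      (a ^ (k + 1) * b ^ (n - k) * (n.choose k : ℝ)) • (g ^ (n - k) * (f ^ k * (1 - f))) := by
    rw [add_pow, sum_mul]
    refine sum_congr rfl fun k _ => ?_
    rw [smul_pow, smul_pow]
    simp only [smul_eq_C_mul, map_mul, map_pow, map_natCast]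
    ring
  have hterm : ∀ k, (n + 1 : ℝ≥0∞) *
      psNorm ((a ^ (k + 1) * b ^ (n - k) * (n.choose k : ℝ)) • (g ^ (n - k) * (f ^ k * (1 - f))))
      ≤ ENNReal.ofReal (a ^ (k + 1) * b ^ (n - k) * ((n + 1).choose (k + 1) : ℝ)) * C := by
    intro k
    have hnn : 0 ≤ a ^ (k + 1) * b ^ (n - k) := by positivity
    have hch : (n + 1 : ℝ≥0∞) * (n.choose k : ℝ≥0∞)
        = ((n + 1).choose (k + 1) : ℝ≥0∞) * (k + 1) := by
      exact_mod_cast Nat.add_one_mul_choose_eq n k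
    rw [psNorm_smul, Real.enorm_of_nonneg (by positivity), ENNReal.ofReal_mul hnn,
      ENNReal.ofReal_mul hnn, ENNReal.ofReal_natCast, ENNReal.ofReal_natCast]
    calc _ ≤ (n + 1 : ℝ≥0∞) * (ENNReal.ofReal (a ^ (k + 1) * b ^ (n - k)) * (n.choose k : ℝ≥0∞)
              * psNorm (f ^ k * (1 - f))) := by
            gcongr
            exact psNorm_mul_le_of_le_one (psNorm_pow_le_one hg _) _
      _ = ENNReal.ofReal (a ^ (k + 1) * b ^ (n - k)) *
            (((n + 1 : ℝ≥0∞) * (n.choose k : ℝ≥0∞)) * psNorm (f ^ k * (1 - f))) := by ring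
      _ = ENNReal.ofReal (a ^ (k + 1) * b ^ (n - k)) * ((n + 1).choose (k + 1) : ℝ≥0∞) *
            ((k + 1 : ℝ≥0∞) * psNorm (f ^ k * (1 - f))) := by rw [hch]; ring
      _ ≤ _ := by gcongr; exact hC k
  -- These are the terms of `(a + b) ^ (n + 1) = 1` other than `b ^ (n + 1)`.
  have hsum : ∑ k ∈ range (n + 1), a ^ (k + 1) * b ^ (n - k) * ((n + 1).choose (k + 1) : ℝ)
      ≤ 1 := by
    have h := add_pow a b (n + 1)
    rw [hab, one_pow, sum_range_succ'] at h
    simp only [Nat.add_sub_add_right] at h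
    rw [h]
    exact le_add_of_nonneg_right (by positivity)
  rw [hexp]
  calc _ ≤ (n + 1 : ℝ≥0∞) * ∑ k ∈ range (n + 1), psNorm ((a ^ (k + 1) * b ^ (n - k) *
            (n.choose k : ℝ)) • (g ^ (n - k) * (f ^ k * (1 - f)))) := by
          gcongr
          exact psNorm_sum_le _ _
    _ ≤ ∑ k ∈ range (n + 1),
          ENNReal.ofReal (a ^ (k + 1) * b ^ (n - k) * ((n + 1).choose (k + 1) : ℝ)) * C := by
        rw [mul_sum]
        exact sum_le_sum fun k _ => hterm k
    _ = ENNReal.ofReal (∑ k ∈ range (n + 1),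
          a ^ (k + 1) * b ^ (n - k) * ((n + 1).choose (k + 1) : ℝ)) * C := by
        rw [← sum_mul, ENNReal.ofReal_sum_of_nonneg fun k _ => by positivity]
    _ ≤ C := mul_le_of_le_one_left' (ENNReal.ofReal_le_one.2 hsum)

lemma RittBound.convex {f g : ℝ⟦X⟧} {C D : ℝ≥0∞} (hf : psNorm f ≤ 1) (hg : psNorm g ≤ 1)
    (hC : RittBound f C) (hD : RittBound g D) {a b : ℝ} (ha : 0 ≤ a) (hb : 0 ≤ b)
    (hab : a + b = 1) : RittBound (a • f + b • g) (C + D) := by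
  intro n
  have h : 1 - (a • f + b • g) = a • (1 - f) + b • (1 - g) := by
    have h1 : (1 : ℝ⟦X⟧) = a • 1 + b • 1 := by rw [← add_smul, hab, one_smul]
    rw [smul_sub, smul_sub]
    nth_rewrite 1 [h1]
    abel
  rw [h]
  refine le_trans ?_ (add_le_add (hC.convex_aux hg ha hb hab n)
    (hD.convex_aux hf hb ha ((add_comm b a).trans hab) n))
  rw [← mul_add, add_comm (b • g) (a • f), mul_add ((a • f + b • g) ^ n)]
  exact mul_le_mul_right (psNorm_add_le _ _) _

lemma convex_classA : Convex ℝ classA := by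
  intro F hF G hG a b ha hb hab
  rw [mem_classA_iff] at *
  obtain ⟨hFp, C, hC, hFC⟩ := hF
  obtain ⟨hGp, D, hD, hGD⟩ := hG
  refine ⟨convex_prob hFp hGp ha hb hab, C + D, ENNReal.add_lt_top.2 ⟨hC, hD⟩, ?_⟩
  have h : PowerSeries.mk (a • F + b • G) = a • PowerSeries.mk F + b • PowerSeries.mk G := by
    ext k; simp
  rw [h]
  exact hFC.convex (by rw [psNorm_mk, (mem_prob_iff.1 hFp).2])
    (by rw [psNorm_mk, (mem_prob_iff.1 hGp).2]) hGD ha hb hab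

lemma conv_mem_classA {F G : ℕ → ℝ} (hF : F ∈ classA) (hG : G ∈ classA) :
    conv F G ∈ classA := by
  rw [mem_classA_iff] at *
  obtain ⟨hFp, C, hC, hFC⟩ := hF
  obtain ⟨hGp, D, hD, hGD⟩ := hG
  refine ⟨conv_mem_prob hFp hGp, C + D, ENNReal.add_lt_top.2 ⟨hC, hD⟩, ?_⟩
  rw [mk_conv]
  exact hFC.mul (by rw [psNorm_mk, (mem_prob_iff.1 hFp).2])
    (by rw [psNorm_mk, (mem_prob_iff.1 hGp).2]) hGD

/-! ### Subordination -/

/-- Tonelli in `[0, ∞]`, so no summability is needed. It gives both the contractivity of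
subordination and the tail estimate for the series. -/
lemma l1Norm_tsum_mul_le (a : ℕ → ℝ) {P : ℕ → ℕ → ℝ} (hP : ∀ k, l1Norm (P k) ≤ 1) :
    l1Norm (fun m => ∑' k, a k * P k m) ≤ l1Norm a := by
  calc l1Norm (fun m => ∑' k, a k * P k m) ≤ ∑' m, ∑' k, ‖a k * P k m‖ₑ :=
        ENNReal.tsum_le_tsum fun m => enorm_tsum_le_tsum_enorm
    _ = ∑' k, ‖a k‖ₑ * l1Norm (P k) := by
        rw [ENNReal.tsum_comm]
        simp only [enorm_mul, ENNReal.tsum_mul_left, l1Norm]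
    _ ≤ l1Norm a := ENNReal.tsum_le_tsum fun k => mul_le_of_le_one_right' (hP k)

lemma summable_norm_mul_convPow {F G : ℕ → ℝ} (hF : Summable F) (hG : G ∈ Prob) (m : ℕ) :
    Summable fun k => ‖F k * convPow G k m‖ := by
  refine Summable.of_nonneg_of_le (fun _ => norm_nonneg _) (fun k => ?_) hF.norm
  have hk := convPow_mem_prob hG k
  rw [norm_mul, Real.norm_of_nonneg (hk.1 m)]
  exact mul_le_of_le_one_right (norm_nonneg _) (le_hasSum hk.2 m fun j _ => hk.1 j)

lemma subord_mem_prob {F G : ℕ → ℝ} (hF : F ∈ Prob) (hG : G ∈ Prob) : subord F G ∈ Prob := by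
  have h0 : ∀ m k, 0 ≤ F k * convPow G k m := fun m k =>
    mul_nonneg (hF.1 k) ((convPow_mem_prob hG k).1 m)
  refine mem_prob_iff.2 ⟨fun m => tsum_nonneg (h0 m), ?_⟩
  calc l1Norm (subord F G) = ∑' m, ∑' k, ‖F k * convPow G k m‖ₑ := by
        refine tsum_congr fun m => ?_
        rw [subord, Real.enorm_of_nonneg (tsum_nonneg (h0 m)), ENNReal.ofReal_tsum_of_nonneg (h0 m)
          (summable_norm_mul_convPow hF.2.summable hG m).of_norm]
        exact tsum_congr fun k => (Real.enorm_of_nonneg (h0 m k)).symm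
    _ = ∑' k, ‖F k‖ₑ * l1Norm (convPow G k) := by
        rw [ENNReal.tsum_comm]
        simp only [enorm_mul, ENNReal.tsum_mul_left, l1Norm]
    _ = l1Norm F := tsum_congr fun k => by
        rw [(mem_prob_iff.1 (convPow_mem_prob hG k)).2, mul_one]
    _ = 1 := (mem_prob_iff.1 hF).2

lemma subord_dirac_zero (G : ℕ → ℝ) : subord (dirac 0) G = dirac 0 := by
  funext m
  rw [subord, tsum_eq_single 0 fun k hk => by simp [dirac, hk]]
  simp [convPow, dirac]

lemma subord_sub {F H G : ℕ → ℝ} (hF : Summable F) (hH : Summable H) (hG : G ∈ Prob) :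
    subord (F - H) G = subord F G - subord H G := by
  funext m
  simp only [subord, Pi.sub_apply, sub_mul]
  exact (summable_norm_mul_convPow hF hG m).of_norm.tsum_sub
    (summable_norm_mul_convPow hH hG m).of_norm

/-- The Cauchy product groups the pairs `(k, l)` by `k + l = n`, and `G^{(k)} * G^{(l)} = G^{(n)}`
depends only on `n`. -/
lemma subord_conv {F H G : ℕ → ℝ} (hF : Summable F) (hH : Summable H) (hG : G ∈ Prob) :
    subord (conv F H) G = conv (subord F G) (subord H G) := by
  funext m
  have hprod : ∀ p : ℕ × ℕ, subord F G p.1 * subord H G p.2 = ∑' n, ∑ q ∈ antidiagonal n,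
      F q.1 * convPow G q.1 p.1 * (H q.2 * convPow G q.2 p.2) := fun p =>
    tsum_mul_tsum_eq_tsum_sum_antidiagonal_of_summable_norm
      (summable_norm_mul_convPow hF hG p.1) (summable_norm_mul_convPow hH hG p.2)
  have hsum : ∀ p ∈ antidiagonal m, Summable fun n => ∑ q ∈ antidiagonal n,
      F q.1 * convPow G q.1 p.1 * (H q.2 * convPow G q.2 p.2) := fun p _ =>
    (summable_norm_sum_mul_antidiagonal_of_summable_norm
      (summable_norm_mul_convPow hF hG p.1) (summable_norm_mul_convPow hH hG p.2)).of_norm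
  rw [conv, sum_congr rfl fun p _ => hprod p, ← Summable.tsum_finsetSum hsum, subord]
  refine tsum_congr fun n => ?_
  rw [sum_comm, conv, sum_mul]
  refine sum_congr rfl fun q hq => ?_
  rw [← mem_antidiagonal.1 hq, ← conv_convPow, conv, mul_sum]
  exact sum_congr rfl fun p _ => by ring

lemma convPow_subord {F G : ℕ → ℝ} (hF : F ∈ Prob) (hG : G ∈ Prob) (n : ℕ) :
    convPow (subord F G) n = subord (convPow F n) G := by
  induction n with
  | zero => exact (subord_dirac_zero G).symm
  | succ n ih =>
    rw [convPow, ih, convPow,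
      subord_conv hF.2.summable (convPow_mem_prob hF n).2.summable hG]

lemma subord_mem_classA {F G : ℕ → ℝ} (hF : F ∈ classA) (hG : G ∈ Prob) :
    subord F G ∈ classA := by
  refine ⟨subord_mem_prob hF.1 hG, lt_of_le_of_lt (iSup₂_mono fun n _ => ?_) hF.2⟩
  -- The difference of consecutive powers is itself subordinated to `G`, so the supremum does not
  -- increase.
  rw [convPow_subord hF.1 hG, convPow_subord hF.1 hG,
    ← subord_sub (convPow_mem_prob hF.1 _).2.summable (convPow_mem_prob hF.1 _).2.summable hG]
  exact mul_le_mul_right (l1Norm_tsum_mul_le _ fun k =>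
    (mem_prob_iff.1 (convPow_mem_prob hG k)).2.le) _

lemma tendsto_l1Norm_subord_sub_sum {F G : ℕ → ℝ} (hF : F ∈ Prob) (hG : G ∈ Prob) :
    Filter.Tendsto
      (fun N : ℕ => l1Norm (subord F G - ∑ k ∈ range N, F k • convPow G k))
      Filter.atTop (nhds 0) := by
  have hfin : ∑' k, ‖F k‖ₑ ≠ ∞ := by
    have h : l1Norm F = 1 := (mem_prob_iff.1 hF).2
    rw [l1Norm] at h
    simp [h]
  refine tendsto_of_tendsto_of_tendsto_of_le_of_le tendsto_const_nhds
    (ENNReal.tendsto_sum_nat_add _ hfin) (fun _ => zero_le) fun N => ?_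
  -- The remainder is a series of the same kind with shifted coefficients, so its norm is at most
  -- the tail of `∑ ‖F k‖ₑ`.
  have h : subord F G - ∑ k ∈ range N, F k • convPow G k
      = fun m => ∑' k, F (k + N) * convPow G (k + N) m := by
    funext m
    rw [Pi.sub_apply, subord,
      ← (summable_norm_mul_convPow hF.2.summable hG m).of_norm.sum_add_tsum_nat_add N]
    simp
  simp only [h]
  exact l1Norm_tsum_mul_le (fun k => F (k + N)) fun k =>
    (mem_prob_iff.1 (convPow_mem_prob hG (k + N))).2.le

end RittProb

theorem proposition4p2 :
    (RittProb.classA ⊆ RittProb.Prob ∧ Convex ℝ RittProb.classA) ∧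
    (∀ F₁ ∈ RittProb.classA, ∀ F₂ ∈ RittProb.classA,
      RittProb.conv F₁ F₂ ∈ RittProb.classA) ∧
    (∀ F₁ ∈ RittProb.classA, ∀ G ∈ RittProb.Prob,
      Filter.Tendsto
        (fun N : ℕ => RittProb.l1Norm
          (RittProb.subord F₁ G - ∑ k ∈ Finset.range N, F₁ k • RittProb.convPow G k))
        Filter.atTop (nhds 0) ∧
      RittProb.subord F₁ G ∈ RittProb.classA) :=
  ⟨⟨fun _ hF => hF.1, RittProb.convex_classA⟩,
    fun _ hF₁ _ hF₂ => RittProb.conv_mem_classA hF₁ hF₂,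
    fun _ hF₁ _ hG => ⟨RittProb.tendsto_l1Norm_subord_sub_sum hF₁.1 hG,
      RittProb.subord_mem_classA hF₁ hG⟩⟩
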